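/- Let $\mathbb B_n=\{z\in\mathbb C^n:|z|<1\}$ be the Euclidean unit ball, $\mathbf b\in\mathbb C^n\setminus\{0\}$, $\beta>1$, and for $z\in\mathbb B_n$ put $S_z=\{t\in\mathbb C: z+t\mathbf b\in\mathbb B_n\}$. Let $Q_{\mathbf b,\beta}(\mathbb B_n)$ be the class of continuous functions $L:\mathbb B_n\to(0,\infty)$ such that $L(z)>\frac{\beta|\mathbf b|}{1-|z|}$ for all $z\in\mathbb B_n$ and, for every $\eta\in[0,\beta]$, $0<\lambda_1(\eta)\le\lambda_2(\eta)<\infty$, where $\lambda_1(\eta)$ and $\lambda_2(\eta)$ are the infimum and the supremum of $\frac{L(z+t\mathbf b)}{L(z+t_0\mathbf b)}$ over all $z\in\mathbb B_n$, $t_0\in S_z$ and $t\in\mathbb C$ with $|t-t_0|\le\frac{\eta}{L(z+t_0\mathbf b)}$ (these points $z+t\mathbf b$ lie in $\mathbb B_n$). Let $F$ be analytic in $\mathbb B_n$, and put $\frac{\partial F}{\partial\mathbf b}=\sum_{j=1}^n b_j\frac{\partial F}{\partial z_j}$, $\frac{\partial^0F}{\partial\mathbf b^0}=F$, $\frac{\partial^kF}{\partial\mathbf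 b^k}=\frac{\partial}{\partial\mathbf b}\frac{\partial^{k-1}F}{\partial\mathbf b^{k-1}}$. The function $F$ is of bounded $L$-index in the direction $\mathbf b$ if there is $m_0\in\mathbb Z_{\ge0}$ such that for all $m\in\mathbb Z_{\ge0}$ and all $z\in\mathbb B_n$ $$\frac{1}{m!\,L^m(z)}\left|\frac{\partial^mF(z)}{\partial\mathbf b^m}\right|\le\max\left\{\frac{1}{k!\,L^k(z)}\left|\frac{\partial^kF(z)}{\partial\mathbf b^k}\right|:0\le k\le m_0\right\}.$$ For $r>0$ and $z^0\in\mathbb B_n$ let $G_r^{\mathbf b}(F,z^0)=\{z^0+t\mathbf b:t\in S_{z^0}\}$ if $F(z^0+t\mathbf b)=0$ for all $t\in S_{z^0}$, and otherwise let $G_r^{\mathbf b}(F,z^0)=\bigcup_a\left\{z^0+t\mathbf b:|t-a|\le\frac{r}{L(z^0+a\mathbf b)}\right\}$, the union being over all zeros $a\in S_{z^0}$ of $t\mapsto F(z^0+t\mathbf b)$ (so it is empty if there are no zeros). Put $G_r^{\mathbf b}(F)=\bigcup_{z^0\in\mathbb B_n}G_r^{\mathbf b}(F,z^0)$. For $\rho>0$,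 $z^0\in\mathbb B_n$ and $t_0\in S_{z^0}$ let $n(\rho,z^0,t_0,1/F)$ be the number, counted with multiplicity, of zeros $a\in S_{z^0}$ of $t\mapsto F(z^0+t\mathbf b)$ with $|a-t_0|\le\rho$. **Theorem.** Let $F$ be analytic in $\mathbb B_n$, let $L\in Q_{\mathbf b,\beta}(\mathbb B_n)$, and suppose $\mathbb B_n\setminus G_\beta^{\mathbf b}(F)\ne\emptyset$. Then $F$ is of bounded $L$-index in the direction $\mathbf b$ if and only if both of the following hold: 1) for every $r\in(0,\beta]$ there exists $P=P(r)>0$ such that for every $z\in\mathbb B_n\setminus G_r^{\mathbf b}(F)$ $$\left|\frac{1}{F(z)}\frac{\partial F(z)}{\partial\mathbf b}\right|\le P\,L(z);$$ 2) for every $r\in(0,\beta]$ there exists $\tilde n(r)\in\mathbb Z_{\ge0}$ such that for every $z^0\in\mathbb B_n$ for which $t\mapsto F(z^0+t\mathbf b)$ is not identically zero on $S_{z^0}$, and for every $t_0\in S_{z^0}$, $$n\left(\frac{r}{L(z^0+t_0\mathbf b)},z^0,t_0,\frac1F\right)\le\tilde n(r).$$ -/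

import Mathlib

open scoped ENNReal

/-- The directional derivative `∂F/∂b = ∑ⱼ (∂F/∂zⱼ) bⱼ`. -/
noncomputable def dirDeriv {n : ℕ} (b : EuclideanSpace ℂ (Fin n))
    (F : EuclideanSpace ℂ (Fin n) → ℂ) : EuclideanSpace ℂ (Fin n) → ℂ :=
  fun z => fderiv ℂ F z b

/-- The iterated directional derivative: `∂⁰F/∂b⁰ = F`, `∂ᵏ⁺¹F/∂bᵏ⁺¹ = ∂/∂b (∂ᵏF/∂bᵏ)`. -/
noncomputable def iterDirDeriv {n : ℕ} (b : EuclideanSpace ℂ (Fin n)) :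
    ℕ → (EuclideanSpace ℂ (Fin n) → ℂ) → EuclideanSpace ℂ (Fin n) → ℂ
  | 0, F => F
  | k + 1, F => dirDeriv b (iterDirDeriv b k F)

/-- The open unit ball of `ℂⁿ` for the Euclidean norm. -/
def unitBall (n : ℕ) : Set (EuclideanSpace ℂ (Fin n)) := Metric.ball 0 1

/-- `S_z = {t ∈ ℂ : z + t b ∈ 𝔹ₙ}`. -/
def sliceDomain {n : ℕ} (b z : EuclideanSpace ℂ (Fin n)) : Set ℂ :=
  {t : ℂ | z + t • b ∈ unitBall n}

/-- `F` (analytic in the unit ball) is of bounded `L`-index in the direction `b`. -/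
def HasBoundedLIndexInDirection {n : ℕ} (b : EuclideanSpace ℂ (Fin n))
    (L : EuclideanSpace ℂ (Fin n) → ℝ) (F : EuclideanSpace ℂ (Fin n) → ℂ) : Prop :=
  ∃ m₀ : ℕ, ∀ m : ℕ, ∀ z ∈ unitBall n,
    ‖iterDirDeriv b m F z‖ / ((m.factorial : ℝ) * L z ^ m) ≤
      (Finset.range (m₀ + 1)).sup' Finset.nonempty_range_add_one
        (fun k => ‖iterDirDeriv b k F z‖ / ((k.factorial : ℝ) * L z ^ k))

/-- `λ₁(η)`: the infimum of `L (z + t b) / L (z + t₀ b)` over all `z ∈ 𝔹ₙ`, `t₀ ∈ S_z` and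
`|t - t₀| ≤ η / L (z + t₀ b)`. -/
noncomputable def lambdaInf {n : ℕ} (b : EuclideanSpace ℂ (Fin n))
    (L : EuclideanSpace ℂ (Fin n) → ℝ) (η : ℝ) : ℝ≥0∞ :=
  ⨅ z ∈ unitBall n, ⨅ t₀ ∈ sliceDomain b z,
    ⨅ t ∈ Metric.closedBall t₀ (η / L (z + t₀ • b)),
      ENNReal.ofReal (L (z + t • b) / L (z + t₀ • b))

/-- `λ₂(η)`: the supremum of `L (z + t b) / L (z + t₀ b)` over all `z ∈ 𝔹ₙ`, `t₀ ∈ S_z` and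
`|t - t₀| ≤ η / L (z + t₀ b)`. -/
noncomputable def lambdaSup {n : ℕ} (b : EuclideanSpace ℂ (Fin n))
    (L : EuclideanSpace ℂ (Fin n) → ℝ) (η : ℝ) : ℝ≥0∞ :=
  ⨆ z ∈ unitBall n, ⨆ t₀ ∈ sliceDomain b z,
    ⨆ t ∈ Metric.closedBall t₀ (η / L (z + t₀ • b)),
      ENNReal.ofReal (L (z + t • b) / L (z + t₀ • b))

/-- The class `Q_{b,β}(𝔹ₙ)` of positive continuous functions `L` on the unit ball with
`L z > β |b| / (1 - |z|)` and `0 < λ₁(η) ≤ λ₂(η) < ∞` for every `η ∈ [0, β]`. Only the values of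
`L` in the ball matter: by the lower bound the discs in `λ₁`, `λ₂` stay inside the ball. -/
structure MemQ {n : ℕ} (b : EuclideanSpace ℂ (Fin n)) (β : ℝ)
    (L : EuclideanSpace ℂ (Fin n) → ℝ) : Prop where
  continuousOn : ContinuousOn L (unitBall n)
  pos : ∀ z ∈ unitBall n, 0 < L z
  lower_bound : ∀ z ∈ unitBall n, β * ‖b‖ / (1 - ‖z‖) < L z
  lambda : ∀ η ∈ Set.Icc (0 : ℝ) β,
    0 < lambdaInf b L η ∧ lambdaInf b L η ≤ lambdaSup b L η ∧ lambdaSup b L η < ⊤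

/-- The zeros `a ∈ S_{z₀}` of the slice function `t ↦ F (z₀ + t b)`. -/
def sliceZeros {n : ℕ} (b : EuclideanSpace ℂ (Fin n)) (F : EuclideanSpace ℂ (Fin n) → ℂ)
    (z₀ : EuclideanSpace ℂ (Fin n)) : Set ℂ :=
  {a ∈ sliceDomain b z₀ | F (z₀ + a • b) = 0}

open Classical in
/-- `G_r^b(F, z₀)`: the whole slice if the slice function vanishes identically, and otherwise the
union over its zeros `a` of `{z₀ + t b : |t - a| ≤ r / L (z₀ + a b)}` (empty without zeros). -/
noncomputable def sliceExceptionalSet {n : ℕ} (b : EuclideanSpace ℂ (Fin n))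
    (L : EuclideanSpace ℂ (Fin n) → ℝ) (F : EuclideanSpace ℂ (Fin n) → ℂ) (r : ℝ)
    (z₀ : EuclideanSpace ℂ (Fin n)) : Set (EuclideanSpace ℂ (Fin n)) :=
  if ∀ t ∈ sliceDomain b z₀, F (z₀ + t • b) = 0 then
    (fun t : ℂ => z₀ + t • b) '' sliceDomain b z₀
  else
    ⋃ a ∈ sliceZeros b F z₀,
      (fun t : ℂ => z₀ + t • b) '' Metric.closedBall a (r / L (z₀ + a • b))

/-- `G_r^b(F)`: the union of `G_r^b(F, z₀)` over all `z₀ ∈ 𝔹ₙ`. -/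
noncomputable def exceptionalSet {n : ℕ} (b : EuclideanSpace ℂ (Fin n))
    (L : EuclideanSpace ℂ (Fin n) → ℝ) (F : EuclideanSpace ℂ (Fin n) → ℂ) (r : ℝ) :
    Set (EuclideanSpace ℂ (Fin n)) :=
  ⋃ z₀ ∈ unitBall n, sliceExceptionalSet b L F r z₀

/-- `n(ρ, z₀, t₀, 1/F)`: the number, with multiplicity, of zeros `a` of the slice function
`t ↦ F (z₀ + t b)` with `|a - t₀| ≤ ρ`. The sum of the multiplicities is written as the supremum
of its finite partial sums, so that it is `⊤` when there are infinitely many zeros. -/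
noncomputable def zeroCount {n : ℕ} (b : EuclideanSpace ℂ (Fin n))
    (F : EuclideanSpace ℂ (Fin n) → ℂ) (ρ : ℝ) (z₀ : EuclideanSpace ℂ (Fin n)) (t₀ : ℂ) : ℕ∞ :=
  ⨆ (s : Finset ℂ) (_ : (s : Set ℂ) ⊆ sliceZeros b F z₀ ∩ Metric.closedBall t₀ ρ),
    ∑ a ∈ s, analyticOrderAt (fun t : ℂ => F (z₀ + t • b)) a

/-!
For `z` in the ball rescale the slice of `F` through `z` to `h_z(w) = F (z + (w / L z) b)`. The
lower bound on `L` makes `h_z` analytic on the closed disc of radius `β > 1`, and `F` has bounded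
`L`-index exactly when the Taylor coefficients of every `h_z` at the origin are dominated by one of
index at most `N`, with `N` independent of `z`.

If they are, let `M` be the largest one. Then `h_z` is at most `2 M` on the disc of radius `1 / 2`.
Many zeros in the disc of radius `1 / 8` would make `h_z` so small there that Cauchy's estimate
contradicts the choice of `M`, so their number is bounded; and if `h_z` has no zeros near the
origin, Borel-Carathéodory for `log h_z`, again with Cauchy's estimate, bounds `M` by a multiple of
`|h_z(0)|`, which bounds the logarithmic derivative at the origin. Since `L` varies by a bounded
factor on the discs of radius `β / L`, finitely many discs of radius `1 / 8` for recentred slices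
cover the disc of radius `β`, which bounds the number of zeros there.

Conversely, divide `h_z` by its at most `q` zeros in the disc of radius `β`. Some circle of radius
greater than one avoids all of them by a fixed margin, and on it the logarithmic derivative of the
quotient is bounded; by the maximum principle the bound holds inside, so `h_z` on this circle is at
most a constant times its value at a point of `[0, 1 / 2]` that is far from the zeros. By Cauchy's
estimate the Taylor coefficients of high index are then too small to matter.
-/

open Metric

section ZeroCount

variable {𝕜 E : Type*} [NontriviallyNormedField 𝕜] [NormedAddCommGroup E] [NormedSpace 𝕜 E]
  {h : 𝕜 → E} {K K' U : Set 𝕜}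

/-- The number of zeros of `h` in `K`, counted with multiplicity, as the supremum of the finite
partial sums. Points of `K` where `h` does not vanish have order `0`, so they need not be excluded;
so do, by convention, points where `h` is not analytic. -/
noncomputable def zeroCountOn (h : 𝕜 → E) (K : Set 𝕜) : ℕ∞ :=
  ⨆ (s : Finset 𝕜) (_ : (s : Set 𝕜) ⊆ K), ∑ a ∈ s, analyticOrderAt h a

lemma sum_analyticOrderAt_le_zeroCountOn {s : Finset 𝕜} (hs : (s : Set 𝕜) ⊆ K) :
    ∑ a ∈ s, analyticOrderAt h a ≤ zeroCountOn h K :=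
  le_iSup₂_of_le s hs le_rfl

lemma zeroCountOn_mono (hK : K ⊆ K') : zeroCountOn h K ≤ zeroCountOn h K' :=
  iSup₂_le fun _ hs => sum_analyticOrderAt_le_zeroCountOn (hs.trans hK)

lemma zeroCountOn_inter_zeros (h : 𝕜 → E) (K : Set 𝕜) :
    zeroCountOn h (K ∩ {a | h a = 0}) = zeroCountOn h K := by
  classical
  refine le_antisymm (zeroCountOn_mono Set.inter_subset_left) (iSup₂_le fun s hs => ?_)
  have hfilter : ∑ a ∈ s with h a = 0, analyticOrderAt h a = ∑ a ∈ s, analyticOrderAt h a :=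
    Finset.sum_filter_of_ne fun a _ ha => (analyticOrderAt_ne_zero.mp ha).2
  rw [← hfilter]
  refine sum_analyticOrderAt_le_zeroCountOn fun a ha => ?_
  obtain ⟨has, ha0⟩ := Finset.mem_filter.mp ha
  exact ⟨hs has, ha0⟩

lemma zeroCountOn_union_le (h : 𝕜 → E) (K K' : Set 𝕜) :
    zeroCountOn h (K ∪ K') ≤ zeroCountOn h K + zeroCountOn h K' := by
  classical
  refine iSup₂_le fun s hs => ?_
  rw [← Finset.sum_filter_add_sum_filter_not s (· ∈ K)]
  refine add_le_add (sum_analyticOrderAt_le_zeroCountOn fun a ha => (Finset.mem_filter.mp ha).2)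
    (sum_analyticOrderAt_le_zeroCountOn fun a ha => ?_)
  obtain ⟨has, haK⟩ := Finset.mem_filter.mp ha
  exact (hs has).resolve_left haK

lemma zeroCountOn_biUnion_le {ι : Type*} (h : 𝕜 → E) (T : Finset ι) (K : ι → Set 𝕜) :
    zeroCountOn h (⋃ i ∈ T, K i) ≤ ∑ i ∈ T, zeroCountOn h (K i) := by
  classical
  induction T using Finset.induction_on with
  | empty => simp [zeroCountOn, Set.subset_empty_iff]
  | insert i T hi ih =>
    rw [Finset.set_biUnion_insert, Finset.sum_insert hi]
    exact (zeroCountOn_union_le h _ _).trans (by gcongr)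

lemma zeroCountOn_comp [CompleteSpace 𝕜] [CharZero 𝕜] {g : 𝕜 → 𝕜} (hg : AnalyticOnNhd 𝕜 g K)
    (hg' : ∀ a ∈ K, deriv g a ≠ 0) (hinj : K.InjOn g) :
    zeroCountOn (h ∘ g) K = zeroCountOn h (g '' K) := by
  classical
  have hsum : ∀ s : Finset 𝕜, (s : Set 𝕜) ⊆ K →
      ∑ a ∈ s, analyticOrderAt (h ∘ g) a = ∑ a ∈ s.image g, analyticOrderAt h a := fun s hs => by
    rw [Finset.sum_image (hinj.mono hs)]
    exact Finset.sum_congr rfl fun a ha =>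
      analyticOrderAt_comp_of_deriv_ne_zero (hg a (hs ha)) (hg' a (hs ha))
  refine le_antisymm (iSup₂_le fun s hs => ?_) (iSup₂_le fun s hs => ?_)
  · rw [hsum s hs]
    exact sum_analyticOrderAt_le_zeroCountOn (by simpa using Set.image_mono hs)
  · obtain ⟨s, hsK, rfl⟩ := Finset.subset_set_image_iff.mp hs
    exact (hsum s hsK).ge.trans (sum_analyticOrderAt_le_zeroCountOn hsK)

lemma zeroCountOn_comp_add_mul [CompleteSpace 𝕜] [CharZero 𝕜] (h : 𝕜 → E) (c : 𝕜) {s : 𝕜}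
    (hs : s ≠ 0) (ρ : ℝ) :
    zeroCountOn (fun w => h (c + w * s)) (closedBall 0 ρ) =
      zeroCountOn h (closedBall c (ρ * ‖s‖)) := by
  have himage : (fun w => c + w * s) '' closedBall 0 ρ = closedBall c (ρ * ‖s‖) := by
    ext a
    constructor
    · rintro ⟨w, hw, rfl⟩
      rw [mem_closedBall_iff_norm, add_sub_cancel_left, norm_mul]
      gcongr
      exact mem_closedBall_zero_iff.mp hw
    · intro ha
      refine ⟨(a - c) / s, ?_, by simp [hs]⟩
      rwa [mem_closedBall_zero_iff, norm_div, div_le_iff₀ (norm_pos_iff.mpr hs),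
        ← mem_closedBall_iff_norm]
  rw [← himage]
  refine zeroCountOn_comp (fun w _ => by fun_prop) (fun w _ => ?_) fun w _ w' _ hww' => ?_
  · simpa using hs
  · simpa [hs] using hww'

lemma zeroCountOn_eq_zero_iff (hh : AnalyticOnNhd 𝕜 h K) :
    zeroCountOn h K = 0 ↔ ∀ a ∈ K, h a ≠ 0 := by
  constructor
  · intro hcount a ha ha0
    have hle := sum_analyticOrderAt_le_zeroCountOn (h := h) (s := {a}) (K := K) (by simpa using ha)
    rw [Finset.sum_singleton, hcount, nonpos_iff_eq_zero] at hle
    exact analyticOrderAt_ne_zero.mpr ⟨hh a ha, ha0⟩ hle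
  · refine fun hne => nonpos_iff_eq_zero.mp (iSup₂_le fun s hs => ?_)
    exact (Finset.sum_eq_zero fun a ha => analyticOrderAt_eq_zero.mpr (.inr (hne a (hs ha)))).le

lemma zeroCountOn_sub_smul {a : 𝕜} (ha : a ∈ K) (hh : AnalyticOnNhd 𝕜 h K) :
    zeroCountOn (fun w => (w - a) • h w) K = zeroCountOn h K + 1 := by
  classical
  have hsum : ∀ s : Finset 𝕜, (s : Set 𝕜) ⊆ K →
      ∑ w ∈ s, analyticOrderAt (fun w => (w - a) • h w) w =
        ∑ w ∈ s, analyticOrderAt h w + if a ∈ s then 1 else 0 := fun s hs => by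
    have horder : ∀ w ∈ s, analyticOrderAt (fun w => (w - a) • h w) w =
        analyticOrderAt h w + if w = a then 1 else 0 := fun w hw => by
      rw [add_comm]
      refine (analyticOrderAt_smul (by fun_prop) (hh w (hs hw))).trans ?_
      split_ifs with hwa
      · rw [hwa, analyticOrderAt_id_sub_const_self]
      · rw [analyticOrderAt_id_sub_const_of_ne hwa]
    rw [Finset.sum_congr rfl horder, Finset.sum_add_distrib, Finset.sum_ite_eq']
  refine le_antisymm (iSup₂_le fun s hs => ?_) ?_
  · rw [hsum s hs]
    exact add_le_add (sum_analyticOrderAt_le_zeroCountOn hs) (by split_ifs <;> simp)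
  · rw [zeroCountOn, ENat.biSup_add' ⟨∅, by simp⟩]
    refine iSup₂_le fun s hs => ?_
    have hins : ((insert a s : Finset 𝕜) : Set 𝕜) ⊆ K := by
      simpa using Set.insert_subset ha hs
    calc ∑ w ∈ s, analyticOrderAt h w + 1
        ≤ ∑ w ∈ insert a s, analyticOrderAt h w + 1 := by
          gcongr
          exact Finset.subset_insert a s
      _ = ∑ w ∈ insert a s, analyticOrderAt (fun w => (w - a) • h w) w := by
          rw [hsum _ hins, if_pos (Finset.mem_insert_self a s)]
      _ ≤ _ := sum_analyticOrderAt_le_zeroCountOn hins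

lemma analyticOnNhd_dslope (hh : AnalyticOnNhd 𝕜 h U) (a : 𝕜) :
    AnalyticOnNhd 𝕜 (dslope h a) U := by
  intro w hw
  rcases eq_or_ne w a with rfl | hwa
  · obtain ⟨p, hp⟩ := hh w hw
    exact ⟨_, hp.has_fpower_series_dslope_fslope⟩
  · refine AnalyticAt.congr ?_ (dslope_eventuallyEq_slope_of_ne h hwa).symm
    have hinv : AnalyticAt 𝕜 (fun w => (w - a)⁻¹) w := by
      fun_prop (disch := exact sub_ne_zero.mpr hwa)
    exact hinv.smul ((hh w hw).sub analyticAt_const)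

lemma exists_eq_prod_sub_smul (hU : K ⊆ U) {k : ℕ} (hh : AnalyticOnNhd 𝕜 h U)
    (hk : k ≤ zeroCountOn h K) :
    ∃ (a : Fin k → 𝕜) (φ : 𝕜 → E), (∀ i, a i ∈ K) ∧ AnalyticOnNhd 𝕜 φ U ∧
      zeroCountOn h K = zeroCountOn φ K + k ∧ h = fun w => (∏ i, (w - a i)) • φ w := by
  induction k generalizing h with
  | zero => exact ⟨Fin.elim0, h, fun i => i.elim0, hh, by simp, by simp⟩
  | succ k ih =>
    obtain ⟨a, ha, ha0⟩ : ∃ a ∈ K, h a = 0 := by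
      by_contra! hne
      rw [(zeroCountOn_eq_zero_iff (hh.mono hU)).mpr hne] at hk
      simp at hk
    have hψ := analyticOnNhd_dslope hh a
    have hfactor : h = fun w => (w - a) • dslope h a w :=
      funext fun w => (sub_smul_dslope_of_zero ha0 w).symm
    have hcount : zeroCountOn h K = zeroCountOn (dslope h a) K + 1 := by
      conv_lhs => rw [hfactor]
      exact zeroCountOn_sub_smul ha (hψ.mono hU)
    rw [hcount, Nat.cast_add, Nat.cast_one, ENat.add_le_add_iff_right ENat.one_ne_top] at hk
    obtain ⟨c, φ, hc, hφ, hφcount, hφe⟩ := ih hψ hk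
    refine ⟨Fin.cons a c, φ, Fin.cases ha hc, hφ, ?_, ?_⟩
    · rw [hcount, hφcount, Nat.cast_add, Nat.cast_one, add_assoc]
    · rw [hfactor, hφe]
      simp [Fin.prod_univ_succ, mul_smul]

lemma exists_zero_free_factor (hh : AnalyticOnNhd 𝕜 h K) {q : ℕ} (hq : zeroCountOn h K ≤ q) :
    ∃ k ≤ q, ∃ (a : Fin k → 𝕜) (φ : 𝕜 → E), (∀ i, a i ∈ K) ∧ AnalyticOnNhd 𝕜 φ K ∧
      (∀ w ∈ K, φ w ≠ 0) ∧ h = fun w => (∏ i, (w - a i)) • φ w := by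
  obtain ⟨k, hk⟩ := ENat.ne_top_iff_exists.mp (ne_top_of_le_ne_top (ENat.natCast_ne_top q) hq)
  obtain ⟨a, φ, ha, hφ, hcount, hφe⟩ := exists_eq_prod_sub_smul subset_rfl hh hk.le
  refine ⟨k, by exact_mod_cast hk.trans_le hq, a, φ, ha, hφ,
    (zeroCountOn_eq_zero_iff hφ).mp ?_, hφe⟩
  rw [← hk] at hcount
  simpa using hcount.symm

end ZeroCount

section NormProd

variable {𝕜 ι : Type*} [NormedField 𝕜] [Fintype ι] {f : ι → 𝕜} {D : ℝ}

lemma norm_prod_le_pow_card (hf : ∀ i, ‖f i‖ ≤ D) : ‖∏ i, f i‖ ≤ D ^ Fintype.card ι := by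
  rw [norm_prod, ← Finset.card_univ, ← Finset.prod_const]
  exact Finset.prod_le_prod (fun i _ => norm_nonneg _) fun i _ => hf i

lemma pow_card_le_norm_prod (hD : 0 ≤ D) (hf : ∀ i, D ≤ ‖f i‖) :
    D ^ Fintype.card ι ≤ ‖∏ i, f i‖ := by
  rw [norm_prod, ← Finset.card_univ, ← Finset.prod_const]
  exact Finset.prod_le_prod (fun i _ => hD) fun i _ => hf i

lemma norm_prod_mul_le_mul_norm {g : ι → 𝕜} {u v : 𝕜} {d C : ℝ} (hd : 0 < d) (hD : 0 ≤ D)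
    (hf : ∀ i, ‖f i‖ ≤ D) (hg : ∀ i, d ≤ ‖g i‖) (huv : ‖u‖ ≤ C * ‖v‖) :
    ‖(∏ i, f i) * u‖ ≤ (D / d) ^ Fintype.card ι * C * ‖(∏ i, g i) * v‖ := by
  have hCv : 0 ≤ C * ‖v‖ := (norm_nonneg u).trans huv
  calc ‖(∏ i, f i) * u‖ = ‖∏ i, f i‖ * ‖u‖ := norm_mul _ _
    _ ≤ D ^ Fintype.card ι * (C * ‖v‖) := by
      gcongr
      exact norm_prod_le_pow_card hf
    _ = (D / d) ^ Fintype.card ι * (C * ‖v‖) * d ^ Fintype.card ι := by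
      rw [div_pow]
      field_simp
    _ ≤ (D / d) ^ Fintype.card ι * (C * ‖v‖) * ‖∏ i, g i‖ := by
      gcongr
      exact pow_card_le_norm_prod hd.le hg
    _ = (D / d) ^ Fintype.card ι * C * ‖(∏ i, g i) * v‖ := by
      rw [norm_mul]
      ring

end NormProd

section TaylorIndex

variable {E : Type*} [NormedAddCommGroup E] [NormedSpace ℂ E] {h : ℂ → E} {N : ℕ}

/-- The norm of the `k`-th Taylor coefficient of `h` at the origin. -/
noncomputable def taylorCoeffNorm (h : ℂ → E) (k : ℕ) : ℝ :=
  ‖iteratedDeriv k h 0‖ / (k.factorial : ℝ)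

/-- The Taylor coefficients of `h` at the origin are dominated by one of index at most `N`. For the
slice of `F` through `z`, rescaled by `L z`, this is the condition on `F` at `z` in the definition
of bounded `L`-index. -/
def HasTaylorIndexLE (h : ℂ → E) (N : ℕ) : Prop :=
  ∃ k ≤ N, ∀ m, taylorCoeffNorm h m ≤ taylorCoeffNorm h k

lemma taylorCoeffNorm_nonneg (h : ℂ → E) (k : ℕ) : 0 ≤ taylorCoeffNorm h k := by
  unfold taylorCoeffNorm
  positivity

lemma taylorCoeffNorm_zero (h : ℂ → E) : taylorCoeffNorm h 0 = ‖h 0‖ := by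
  simp [taylorCoeffNorm]

lemma taylorCoeffNorm_one (h : ℂ → E) : taylorCoeffNorm h 1 = ‖deriv h 0‖ := by
  simp [taylorCoeffNorm]

lemma exists_taylorCoeffNorm_le (h : ℂ → E) (N : ℕ) :
    ∃ k ≤ N, ∀ m ≤ N, taylorCoeffNorm h m ≤ taylorCoeffNorm h k := by
  obtain ⟨k, hk, hmax⟩ := Finset.exists_max_image (Finset.range (N + 1)) (taylorCoeffNorm h)
    Finset.nonempty_range_add_one
  simp only [Finset.mem_range, Nat.lt_succ_iff] at hk hmax
  exact ⟨k, hk, hmax⟩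

lemma hasTaylorIndexLE_of_eventuallyEq_zero (hh : h =ᶠ[nhds 0] 0) (N : ℕ) :
    HasTaylorIndexLE h N :=
  ⟨0, N.zero_le, fun m => by simp [taylorCoeffNorm, hh.iteratedDeriv_eq]⟩

variable [CompleteSpace E]

lemma taylorCoeffNorm_le_div_pow {ρ M : ℝ} (hρ : 0 < ρ) (hh : DiffContOnCl ℂ h (ball 0 ρ))
    (hM : ∀ w ∈ sphere (0 : ℂ) ρ, ‖h w‖ ≤ M) (k : ℕ) : taylorCoeffNorm h k ≤ M / ρ ^ k := by
  rw [taylorCoeffNorm, div_le_iff₀ (by positivity)]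
  refine (Complex.norm_iteratedDeriv_le_of_forall_mem_sphere_norm_le k hρ hh hM).trans_eq ?_
  ring

lemma norm_le_mul_inv_one_sub_norm {M : ℝ} (hh : DifferentiableOn ℂ h (ball 0 1))
    (hM : ∀ m, taylorCoeffNorm h m ≤ M) {w : ℂ} (hw : ‖w‖ < 1) : ‖h w‖ ≤ M * (1 - ‖w‖)⁻¹ := by
  rw [← (Complex.hasSum_taylorSeries_on_ball hh (mem_ball_zero_iff.mpr hw)).tsum_eq]
  refine tsum_of_norm_bounded ((hasSum_geometric_of_lt_one (norm_nonneg w) hw).mul_left M)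
    fun m => ?_
  have hterm : ‖(m.factorial : ℂ)⁻¹ • (w - 0) ^ m • iteratedDeriv m h 0‖ =
      taylorCoeffNorm h m * ‖w‖ ^ m := by
    simp only [taylorCoeffNorm, sub_zero, norm_smul, norm_inv, Complex.norm_natCast, norm_pow]
    ring
  rw [hterm]
  exact mul_le_mul_of_nonneg_right (hM m) (by positivity)

lemma norm_le_two_mul {M : ℝ} (hh : DifferentiableOn ℂ h (ball 0 1))
    (hM : ∀ m, taylorCoeffNorm h m ≤ M) {w : ℂ} (hw : ‖w‖ ≤ 1 / 2) : ‖h w‖ ≤ 2 * M := by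
  have hM0 : 0 ≤ M := (taylorCoeffNorm_nonneg h 0).trans (hM 0)
  have hinv : (1 - ‖w‖)⁻¹ ≤ 2 := by
    rw [inv_le_comm₀ (by linarith) two_pos]
    linarith
  calc ‖h w‖ ≤ M * (1 - ‖w‖)⁻¹ := norm_le_mul_inv_one_sub_norm hh hM (by linarith)
    _ ≤ M * 2 := by gcongr
    _ = 2 * M := mul_comm _ _

lemma HasTaylorIndexLE.of_norm_le {A C : ℝ} (hA : 1 < A) (hh : DiffContOnCl ℂ h (ball 0 A))
    (hN : 4 * C ≤ A ^ N) {w₀ : ℂ} (hw₀ : ‖w₀‖ ≤ 1 / 2)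
    (hC : ∀ w ∈ sphere (0 : ℂ) A, ‖h w‖ ≤ C * ‖h w₀‖) : HasTaylorIndexLE h N := by
  obtain ⟨k, hkN, hk⟩ := exists_taylorCoeffNorm_le h N
  have htail : ∀ m > N, taylorCoeffNorm h m ≤ ‖h w₀‖ / 4 := fun m hm => by
    refine (taylorCoeffNorm_le_div_pow (by linarith) hh hC m).trans ?_
    rw [div_le_iff₀ (by positivity)]
    calc C * ‖h w₀‖ ≤ A ^ N / 4 * ‖h w₀‖ := by gcongr; linarith
      _ ≤ A ^ m / 4 * ‖h w₀‖ := by gcongr; exact hA.le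
      _ = ‖h w₀‖ / 4 * A ^ m := by ring
  have hall : ∀ m, taylorCoeffNorm h m ≤ taylorCoeffNorm h k + ‖h w₀‖ / 4 := fun m => by
    rcases le_or_gt m N with hm | hm
    · linarith [hk m hm, norm_nonneg (h w₀)]
    · linarith [htail m hm, taylorCoeffNorm_nonneg h k]
  have hw₀_le : ‖h w₀‖ ≤ 2 * (taylorCoeffNorm h k + ‖h w₀‖ / 4) :=
    norm_le_two_mul (hh.differentiableOn.mono (ball_subset_ball hA.le)) hall hw₀
  refine ⟨k, hkN, fun m => ?_⟩
  rcases le_or_gt m N with hm | hm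
  · exact hk m hm
  · linarith [htail m hm]

end TaylorIndex

section ZeroBound

variable {E : Type*} [NormedAddCommGroup E] [NormedSpace ℂ E] {h : ℂ → E}

lemma norm_le_of_forall_mem_sphere {c : ℂ} {R C : ℝ} (hR : R ≠ 0)
    (hh : DiffContOnCl ℂ h (ball c R)) (hC : ∀ w ∈ sphere c R, ‖h w‖ ≤ C) {w : ℂ}
    (hw : w ∈ closedBall c R) : ‖h w‖ ≤ C :=
  Complex.norm_le_of_forall_mem_frontier_norm_le isBounded_ball hh
    (fun z hz => hC z (by rwa [frontier_ball c hR] at hz)) (by rwa [closure_ball c hR])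

lemma norm_le_mul_pow_of_le_zeroCountOn {c : ℂ} {ρ R M : ℝ} (hρ : 0 ≤ ρ) (hρR : ρ < R)
    (hh : AnalyticOnNhd ℂ h (closedBall c R)) (hM : ∀ w ∈ sphere c R, ‖h w‖ ≤ M) {k : ℕ}
    (hk : k ≤ zeroCountOn h (closedBall c ρ)) {w : ℂ} (hw : w ∈ closedBall c ρ) :
    ‖h w‖ ≤ M * (2 * ρ / (R - ρ)) ^ k := by
  obtain ⟨a, φ, ha, hφ, -, rfl⟩ :=
    exists_eq_prod_sub_smul (closedBall_subset_closedBall hρR.le) hh hk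
  have hgap : 0 < R - ρ := sub_pos.mpr hρR
  have hφ_sphere : ∀ z ∈ sphere c R, ‖φ z‖ ≤ M / (R - ρ) ^ k := fun z hz => by
    have hprod : (R - ρ) ^ k ≤ ‖∏ i, (z - a i)‖ := by
      simpa using pow_card_le_norm_prod (f := fun i => z - a i) hgap.le fun i => by
        rw [← dist_eq_norm]
        linarith [mem_sphere.mp hz, mem_closedBall.mp (ha i), dist_triangle z (a i) c]
    rw [le_div_iff₀' (by positivity)]
    calc (R - ρ) ^ k * ‖φ z‖ ≤ ‖∏ i, (z - a i)‖ * ‖φ z‖ := by gcongr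
      _ = ‖(∏ i, (z - a i)) • φ z‖ := (norm_smul _ _).symm
      _ ≤ M := hM z hz
  have hφ_w : ‖φ w‖ ≤ M / (R - ρ) ^ k :=
    norm_le_of_forall_mem_sphere (by linarith)
      (hφ.differentiableOn.diffContOnCl_ball subset_rfl) hφ_sphere
      (closedBall_subset_closedBall hρR.le hw)
  have hprod : ‖∏ i, (w - a i)‖ ≤ (2 * ρ) ^ k := by
    simpa using norm_prod_le_pow_card (f := fun i => w - a i) (D := 2 * ρ) fun i => by
      rw [← dist_eq_norm]
      linarith [mem_closedBall.mp hw, mem_closedBall.mp (ha i), dist_triangle_right w (a i) c]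
  calc ‖(∏ i, (w - a i)) • φ w‖ = ‖∏ i, (w - a i)‖ * ‖φ w‖ := norm_smul _ _
    _ ≤ (2 * ρ) ^ k * (M / (R - ρ) ^ k) := by gcongr
    _ = M * (2 * ρ / (R - ρ)) ^ k := by rw [div_pow]; ring

variable [CompleteSpace E]

lemma one_le_of_le_zeroCountOn {N k : ℕ} (hh : AnalyticOnNhd ℂ h (ball 0 1))
    (hN : HasTaylorIndexLE h N) (hne : ∃ w ∈ ball (0 : ℂ) 1, h w ≠ 0)
    (hk : k ≤ zeroCountOn h (closedBall 0 (1 / 8))) : 1 ≤ 2 * 8 ^ N * (2 / 3 : ℝ) ^ k := by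
  obtain ⟨j, hjN, hj⟩ := hN
  set M := taylorCoeffNorm h j
  have hM : 0 < M := by
    by_contra! hM
    obtain ⟨w, hw, hw0⟩ := hne
    rw [mem_ball_zero_iff] at hw
    have hle := norm_le_mul_inv_one_sub_norm hh.differentiableOn (fun m => (hj m).trans hM) hw
    exact hw0 (norm_le_zero_iff.mp (by simpa using hle))
  have hball : ∀ r < 1, closedBall (0 : ℂ) r ⊆ ball 0 1 := fun r => closedBall_subset_ball
  have hsmall : ∀ w ∈ sphere (0 : ℂ) (1 / 8), ‖h w‖ ≤ 2 * M * (2 / 3) ^ k := fun w hw => by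
    refine (norm_le_mul_pow_of_le_zeroCountOn (R := 1 / 2) (by norm_num) (by norm_num)
      (hh.mono (hball _ (by norm_num))) (fun z hz => norm_le_two_mul hh.differentiableOn hj
        (mem_sphere_zero_iff_norm.mp hz).le) hk (sphere_subset_closedBall hw)).trans_eq ?_
    norm_num
  have hcauchy : M ≤ 2 * M * (2 / 3) ^ k / (1 / 8) ^ j :=
    taylorCoeffNorm_le_div_pow (by norm_num)
      (hh.differentiableOn.diffContOnCl_ball (hball _ (by norm_num))) hsmall j
  refine le_of_mul_le_mul_right ?_ hM
  calc 1 * M ≤ 2 * M * (2 / 3) ^ k / (1 / 8) ^ j := by rwa [one_mul]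
    _ = 2 * M * (2 / 3) ^ k * 8 ^ j := by rw [one_div, inv_pow, div_inv_eq_mul]
    _ ≤ 2 * M * (2 / 3) ^ k * 8 ^ N := by gcongr; norm_num
    _ = 2 * 8 ^ N * (2 / 3) ^ k * M := by ring

lemma exists_zeroCountOn_le_of_hasTaylorIndexLE (E : Type*) [NormedAddCommGroup E]
    [NormedSpace ℂ E] [CompleteSpace E] (N : ℕ) :
    ∃ q : ℕ, ∀ h : ℂ → E, AnalyticOnNhd ℂ h (ball 0 1) → HasTaylorIndexLE h N →
      (∃ w ∈ ball (0 : ℂ) 1, h w ≠ 0) → zeroCountOn h (closedBall 0 (1 / 8)) ≤ q := by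
  obtain ⟨q, hq⟩ := exists_pow_lt_of_lt_one (x := 1 / (2 * 8 ^ N : ℝ)) (by positivity)
    (show (2 / 3 : ℝ) < 1 by norm_num)
  refine ⟨q, fun h hh hN hne => ENat.forall_natCast_le_iff_le.mp fun k hk => ?_⟩
  have hone := one_le_of_le_zeroCountOn hh hN hne hk
  rw [lt_div_iff₀' (by positivity)] at hq
  by_contra! hlt
  have hpow : (2 / 3 : ℝ) ^ k ≤ (2 / 3) ^ q :=
    pow_le_pow_of_le_one (by norm_num) (by norm_num) (by exact_mod_cast hlt.le)
  linarith [mul_le_mul_of_nonneg_left hpow (by positivity : (0 : ℝ) ≤ 2 * 8 ^ N)]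

end ZeroBound

section LogDeriv

variable {h : ℂ → ℂ} {c : ℂ} {R : ℝ}

lemma exists_eq_mul_exp (hh : DifferentiableOn ℂ h (ball c R)) (hne : ∀ w ∈ ball c R, h w ≠ 0) :
    ∃ f : ℂ → ℂ, f c = 0 ∧ ∀ w ∈ ball c R,
      HasDerivAt f (logDeriv h w) w ∧ h w = h c * Complex.exp (f w) := by
  have hlog : DifferentiableOn ℂ (logDeriv h) (ball c R) := (hh.deriv isOpen_ball).div hh hne
  obtain ⟨f, hfc, hf⟩ := hlog.isExactOn_ball.with_val_at c 0
  have hderiv : ∀ w ∈ ball c R, HasDerivAt (fun w => h w * Complex.exp (-f w)) 0 w := fun w hw => by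
    refine ((hh.differentiableAt (isOpen_ball.mem_nhds hw)).hasDerivAt.mul
      (hf w hw).neg.cexp).congr_deriv ?_
    rw [logDeriv_apply]
    field_simp [hne w hw]
    ring
  refine ⟨f, hfc, fun w hw => ⟨hf w hw, ?_⟩⟩
  have hconst : h w * Complex.exp (-f w) = h c * Complex.exp (-f c) :=
    isOpen_ball.is_const_of_deriv_eq_zero (convex_ball c R).isPreconnected
      (fun z hz => (hderiv z hz).differentiableAt.differentiableWithinAt)
      (fun z hz => (hderiv z hz).deriv) hw (mem_ball_self (pos_of_mem_ball hw))
  rw [hfc, neg_zero, Complex.exp_zero, mul_one] at hconst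
  rw [← hconst, mul_assoc, ← Complex.exp_add, neg_add_cancel, Complex.exp_zero, mul_one]

lemma norm_sq_le_of_forall_ne_zero {M : ℝ} (hh : DifferentiableOn ℂ h (ball 0 R))
    (hne : ∀ w ∈ ball (0 : ℂ) R, h w ≠ 0) (hM : ∀ w ∈ ball (0 : ℂ) R, ‖h w‖ < M) {w : ℂ}
    (hR : 0 < R) (hw : ‖w‖ ≤ R / 5) : ‖h w‖ ^ 2 ≤ M * ‖h 0‖ := by
  obtain ⟨f, hf0, hf⟩ := exists_eq_mul_exp hh hne
  have h0 : 0 < ‖h 0‖ := norm_pos_iff.mpr (hne 0 (mem_ball_self hR))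
  have hM0 : 0 < M := h0.trans (hM 0 (mem_ball_self hR))
  have hnorm : ∀ z ∈ ball (0 : ℂ) R, ‖h z‖ = ‖h 0‖ * Real.exp (f z).re := fun z hz => by
    rw [(hf z hz).2, norm_mul, Complex.norm_exp]
  set A := Real.log (M / ‖h 0‖) with hA_def
  have hA : 0 < A := Real.log_pos ((one_lt_div h0).mpr (hM 0 (mem_ball_self hR)))
  have hre : Set.MapsTo f (ball 0 R) {z | z.re ≤ A} := fun z hz => by
    have hz_lt := hM z hz
    rw [hnorm z hz, ← lt_div_iff₀' h0] at hz_lt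
    exact (Real.le_log_iff_exp_le (by positivity)).mpr hz_lt.le
  have hwR : w ∈ ball (0 : ℂ) R := mem_ball_zero_iff.mpr (by linarith)
  -- The constant in Borel-Carathéodory is `2ρ / (R - ρ)`, equal to `1 / 2` at `ρ = R / 5`.
  have hcar : ‖f w‖ ≤ A / 2 := by
    refine (Complex.borelCaratheodory_zero hA (fun z hz =>
      (hf z hz).1.differentiableAt.differentiableWithinAt) hre hR hwR hf0).trans ?_
    rw [div_le_iff₀ (by linarith)]
    nlinarith
  calc ‖h w‖ ^ 2 = ‖h 0‖ ^ 2 * Real.exp (2 * (f w).re) := by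
        rw [hnorm w hwR, mul_pow, ← Real.exp_nat_mul, Nat.cast_ofNat]
    _ ≤ ‖h 0‖ ^ 2 * Real.exp A := by
        gcongr
        linarith [Complex.re_le_norm (f w)]
    _ = M * ‖h 0‖ := by
        rw [hA_def, Real.exp_log (by positivity)]
        field_simp

lemma norm_logDeriv_zero_le_of_hasTaylorIndexLE {N : ℕ} {s : ℝ}
    (hh : DifferentiableOn ℂ h (ball 0 1)) (hN : HasTaylorIndexLE h N) (hs : 0 < s)
    (hs2 : s ≤ 1 / 2) (hne : ∀ w ∈ ball (0 : ℂ) s, h w ≠ 0) :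
    ‖logDeriv h 0‖ ≤ 3 * (5 / s) ^ (2 * N) := by
  obtain ⟨k, hkN, hk⟩ := hN
  set M := taylorCoeffNorm h k
  have h0M : ‖h 0‖ ≤ M := taylorCoeffNorm_zero h ▸ hk 0
  have h0 : 0 < ‖h 0‖ := norm_pos_iff.mpr (hne 0 (mem_ball_self hs))
  have hM : 0 < M := h0.trans_le h0M
  have hbound : ∀ w ∈ ball (0 : ℂ) s, ‖h w‖ < 3 * M := fun w hw => by
    rw [mem_ball_zero_iff] at hw
    linarith [norm_le_two_mul hh hk (w := w) (by linarith)]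
  have hcauchy : M ≤ √(3 * M * ‖h 0‖) / (s / 5) ^ k := by
    refine taylorCoeffNorm_le_div_pow (by positivity) (hh.diffContOnCl_ball
      (closedBall_subset_ball (by linarith))) (fun w hw => Real.le_sqrt_of_sq_le ?_) k
    exact norm_sq_le_of_forall_ne_zero (hh.mono (ball_subset_ball (by linarith))) hne hbound hs
      (mem_sphere_zero_iff_norm.mp hw).le
  have hsq : M * M ≤ M * (3 * (5 / s) ^ (2 * k) * ‖h 0‖) :=
    calc M * M = M ^ 2 := (sq M).symm
      _ ≤ (√(3 * M * ‖h 0‖) / (s / 5) ^ k) ^ 2 := by gcongr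
      _ = 3 * M * ‖h 0‖ / (s / 5) ^ (2 * k) := by
        rw [div_pow, Real.sq_sqrt (by positivity), ← pow_mul, mul_comm k]
      _ = M * (3 * (5 / s) ^ (2 * k) * ‖h 0‖) := by
        rw [← inv_div s 5, inv_pow]
        ring
  rw [logDeriv_apply, norm_div, div_le_iff₀ h0]
  calc ‖deriv h 0‖ ≤ M := taylorCoeffNorm_one h ▸ hk 1
    _ ≤ 3 * (5 / s) ^ (2 * k) * ‖h 0‖ := le_of_mul_le_mul_left hsq hM
    _ ≤ 3 * (5 / s) ^ (2 * N) * ‖h 0‖ := by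
      gcongr
      rw [one_le_div hs]
      linarith

end LogDeriv

section IndexBound

lemma exists_mem_Icc_forall_le_abs_sub {ι : Type*} [Fintype ι] (y : ι → ℝ) {q : ℕ}
    (hq : Fintype.card ι ≤ q) {A B : ℝ} (hAB : A < B) :
    ∃ x ∈ Set.Icc A B, ∀ i, (B - A) / (2 * (q + 1)) ≤ |x - y i| := by
  set d := (B - A) / (2 * (q + 1)) with hd
  have hd0 : 0 < d := div_pos (sub_pos.mpr hAB) (by positivity)
  have hBA : B - A = (q + 1) * (2 * d) := by
    rw [hd]
    field_simp
  by_contra! hclose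
  have hcover : Set.Icc A B ⊆ ⋃ i, ball (y i) d := fun x hx => by
    obtain ⟨i, hi⟩ := hclose x hx
    exact Set.mem_iUnion.mpr ⟨i, mem_ball.mpr (by rwa [Real.dist_eq])⟩
  have hvol : ENNReal.ofReal (B - A) ≤ ENNReal.ofReal (q * (2 * d)) :=
    calc ENNReal.ofReal (B - A) = MeasureTheory.volume (Set.Icc A B) := Real.volume_Icc.symm
      _ ≤ ∑ i, MeasureTheory.volume (ball (y i) d) :=
        (MeasureTheory.measure_mono hcover).trans (MeasureTheory.measure_iUnion_fintype_le _ _)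
      _ = Fintype.card ι * ENNReal.ofReal (2 * d) := by simp [Real.volume_ball]
      _ ≤ q * ENNReal.ofReal (2 * d) := by gcongr
      _ = ENNReal.ofReal (q * (2 * d)) := by
        rw [ENNReal.ofReal_mul q.cast_nonneg, ENNReal.ofReal_natCast]
  rw [ENNReal.ofReal_le_ofReal_iff (by positivity)] at hvol
  linarith

lemma norm_logDeriv_le_add_card_div {ι : Type*} [Fintype ι] {a : ι → ℂ} {φ : ℂ → ℂ} {w : ℂ}
    {δ : ℝ} (hφ : DifferentiableAt ℂ φ w) (hφw : φ w ≠ 0) (hδ : 0 < δ)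
    (ha : ∀ i, δ ≤ ‖w - a i‖) :
    ‖logDeriv φ w‖ ≤ ‖logDeriv (fun z => (∏ i, (z - a i)) * φ z) w‖ + Fintype.card ι / δ := by
  have hwa : ∀ i, w - a i ≠ 0 := fun i => norm_pos_iff.mp (hδ.trans_le (ha i))
  have hlog : logDeriv (fun z => (∏ i, (z - a i)) * φ z) w =
      ∑ i, (w - a i)⁻¹ + logDeriv φ w := by
    rw [logDeriv_mul w (Finset.prod_ne_zero_iff.mpr fun i _ => hwa i) hφw (by fun_prop) hφ,
      logDeriv_prod (fun i _ => hwa i) (fun i _ => by fun_prop)]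
    simp [logDeriv_apply]
  have hsum : ‖∑ i, (w - a i)⁻¹‖ ≤ Fintype.card ι / δ := by
    refine (norm_sum_le_of_le _ fun i _ => ?_).trans_eq (b := ∑ _ : ι, δ⁻¹) (by
      simp [div_eq_mul_inv])
    rw [norm_inv]
    exact inv_anti₀ hδ (ha i)
  calc ‖logDeriv φ w‖ = ‖logDeriv (fun z => (∏ i, (z - a i)) * φ z) w - ∑ i, (w - a i)⁻¹‖ := by
        rw [hlog, add_sub_cancel_left]
    _ ≤ _ := (norm_sub_le _ _).trans (by gcongr)

lemma norm_le_exp_mul_norm_of_logDeriv_le {φ : ℂ → ℂ} {c : ℂ} {x R K : ℝ} (hx : 0 < x)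
    (hxR : x < R) (hφ : DifferentiableOn ℂ φ (ball c R)) (hne : ∀ w ∈ ball c R, φ w ≠ 0)
    (hK : ∀ w ∈ sphere c x, ‖logDeriv φ w‖ ≤ K) {w w' : ℂ} (hw : w ∈ closedBall c x)
    (hw' : w' ∈ closedBall c x) : ‖φ w‖ ≤ Real.exp (K * ‖w - w'‖) * ‖φ w'‖ := by
  have hsub : closedBall c x ⊆ ball c R := closedBall_subset_ball hxR
  have hlog : DifferentiableOn ℂ (logDeriv φ) (ball c R) := (hφ.deriv isOpen_ball).div hφ hne
  have hlog_le : ∀ z ∈ closedBall c x, ‖logDeriv φ z‖ ≤ K := fun z =>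
    norm_le_of_forall_mem_sphere hx.ne' (hlog.diffContOnCl_ball hsub) hK
  obtain ⟨f, -, hf⟩ := exists_eq_mul_exp hφ hne
  have hlip : ‖f w - f w'‖ ≤ K * ‖w - w'‖ :=
    (convex_closedBall c x).norm_image_sub_le_of_norm_hasDerivWithin_le
      (fun z hz => (hf z (hsub hz)).1.hasDerivWithinAt) hlog_le hw' hw
  have hφw : φ w = Complex.exp (f w - f w') * φ w' := by
    rw [(hf w (hsub hw)).2, (hf w' (hsub hw')).2, mul_left_comm, ← Complex.exp_add,
      sub_add_cancel]
  rw [hφw, norm_mul, Complex.norm_exp]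
  gcongr
  exact (Complex.re_le_norm _).trans hlip

lemma exists_forall_mem_sphere_norm_logDeriv_le {ι : Type*} [Fintype ι] {a : ι → ℂ} {φ : ℂ → ℂ}
    {c : ℂ} {R₁ R₂ K : ℝ} {q : ℕ} (hq : Fintype.card ι ≤ q) (hR : R₁ < R₂)
    (hφ : AnalyticOnNhd ℂ φ (closedBall c R₂)) (hφ0 : ∀ w ∈ closedBall c R₂, φ w ≠ 0)
    (hK : ∀ w ∈ closedBall c R₂, (∀ i, (R₂ - R₁) / (2 * (q + 1)) ≤ ‖w - a i‖) →
      ‖logDeriv (fun z => (∏ i, (z - a i)) * φ z) w‖ ≤ K) :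
    ∃ x ∈ Set.Icc R₁ R₂, ∀ w ∈ sphere c x,
      ‖logDeriv φ w‖ ≤ K + q / ((R₂ - R₁) / (2 * (q + 1))) := by
  obtain ⟨x, hx, hxa⟩ := exists_mem_Icc_forall_le_abs_sub (fun i => ‖a i - c‖) hq hR
  refine ⟨x, hx, fun w hw => ?_⟩
  have hwR : w ∈ closedBall c R₂ := closedBall_subset_closedBall hx.2 (sphere_subset_closedBall hw)
  have hfar : ∀ i, (R₂ - R₁) / (2 * (q + 1)) ≤ ‖w - a i‖ := fun i => by
    refine (hxa i).trans ?_
    rw [← mem_sphere_iff_norm.mp hw, ← sub_sub_sub_cancel_right w (a i) c]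
    exact abs_norm_sub_norm_le _ _
  have hδ : 0 < (R₂ - R₁) / (2 * (q + 1)) := div_pos (sub_pos.mpr hR) (by positivity)
  refine (norm_logDeriv_le_add_card_div (hφ w hwR).differentiableAt (hφ0 w hwR) hδ hfar).trans ?_
  gcongr
  exact hK w hwR hfar

lemma exists_norm_le_half_forall_norm_le_mul {ι : Type*} [Fintype ι] {a : ι → ℂ} {φ : ℂ → ℂ}
    {x R K : ℝ} {q : ℕ} (hq : Fintype.card ι ≤ q) (hx : 1 < x) (hxR : x < R)
    (ha : ∀ i, ‖a i‖ ≤ R) (hφ : DifferentiableOn ℂ φ (ball 0 R)) (hφ0 : ∀ w ∈ ball 0 R, φ w ≠ 0)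
    (hK : ∀ w ∈ sphere (0 : ℂ) x, ‖logDeriv φ w‖ ≤ K) :
    ∃ y : ℂ, ‖y‖ ≤ 1 / 2 ∧ ∀ w ∈ closedBall (0 : ℂ) x, ‖(∏ i, (w - a i)) * φ w‖ ≤
      (8 * R * (q + 1)) ^ q * Real.exp (K * (2 * R)) * ‖(∏ i, (y - a i)) * φ y‖ := by
  obtain ⟨y, ⟨hy0, hy1⟩, hya⟩ :=
    exists_mem_Icc_forall_le_abs_sub (fun i => (a i).re) hq one_half_pos
  set d : ℝ := (1 / 2 - 0) / (2 * (q + 1)) with hd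
  have hyd : ∀ i, d ≤ ‖(y : ℂ) - a i‖ := fun i => (hya i).trans <| by
    simpa using Complex.abs_re_le_norm ((y : ℂ) - a i)
  have hy : ‖(y : ℂ)‖ ≤ 1 / 2 := by rwa [Complex.norm_of_nonneg hy0]
  have hK0 : 0 ≤ K := (norm_nonneg _).trans (hK x (by simp [abs_of_pos (one_pos.trans hx)]))
  refine ⟨y, hy, fun w hw => ?_⟩
  have hwx : ‖w‖ ≤ x := mem_closedBall_zero_iff.mp hw
  have hgrowth : ‖φ w‖ ≤ Real.exp (K * (2 * R)) * ‖φ y‖ := by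
    refine (norm_le_exp_mul_norm_of_logDeriv_le (w' := y) (by linarith) hxR hφ hφ0 hK hw
      (mem_closedBall_zero_iff.mpr (by linarith))).trans ?_
    gcongr
    linarith [norm_sub_le w y]
  have hdR : 2 * R / d = 8 * R * (q + 1) := by
    rw [hd]
    field_simp
    ring
  have hone : 1 ≤ 8 * R * (q + 1) := by nlinarith [q.cast_nonneg (α := ℝ)]
  refine (norm_prod_mul_le_mul_norm (D := 2 * R) (by positivity) (by linarith)
    (fun i => by linarith [norm_sub_le w (a i), ha i]) hyd hgrowth).trans ?_
  rw [hdR]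
  gcongr

lemma exists_hasTaylorIndexLE_of_norm_logDeriv_le {β : ℝ} (hβ : 1 < β) (q : ℕ) (K : ℝ) :
    ∃ N, ∀ h : ℂ → ℂ, AnalyticOnNhd ℂ h (closedBall 0 β) → zeroCountOn h (closedBall 0 β) ≤ q →
      (∀ w ∈ closedBall 0 ((1 + β) / 2),
        (∀ a ∈ closedBall 0 β, h a = 0 → (β - 1) / (8 * (q + 1)) ≤ ‖w - a‖) →
          ‖logDeriv h w‖ ≤ K) → HasTaylorIndexLE h N := by
  set A := 1 + (β - 1) / 4 with hA
  have hAβ : A < (1 + β) / 2 := by linarith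
  have hδ : (β - 1) / (8 * (q + 1)) = ((1 + β) / 2 - A) / (2 * (q + 1)) := by
    rw [hA]
    field_simp
    ring
  set K' := K + q / (((1 + β) / 2 - A) / (2 * (q + 1)))
  obtain ⟨N, hN⟩ := pow_unbounded_of_one_lt
    (4 * ((8 * β * (q + 1)) ^ q * Real.exp (K' * (2 * β)))) (show 1 < A by linarith)
  refine ⟨N, fun h hh hq hlog => ?_⟩
  obtain ⟨k, hkq, a, φ, ha, hφ, hφ0, hfactor⟩ := exists_zero_free_factor hh hq
  simp only [smul_eq_mul] at hfactor
  have hcard : Fintype.card (Fin k) ≤ q := by rwa [Fintype.card_fin]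
  have hsub : closedBall (0 : ℂ) ((1 + β) / 2) ⊆ closedBall 0 β :=
    closedBall_subset_closedBall (by linarith)
  have hzero : ∀ b ∈ closedBall (0 : ℂ) β, h b = 0 → ∃ i, b = a i := fun b hb hb0 => by
    simpa [hfactor, hφ0 b hb, Finset.prod_eq_zero_iff, sub_eq_zero] using hb0
  obtain ⟨x, ⟨hAx, hxβ⟩, hx⟩ := exists_forall_mem_sphere_norm_logDeriv_le hcard hAβ (hφ.mono hsub)
    (fun w hw => hφ0 w (hsub hw)) fun w hw hfar => hfactor ▸ hlog w hw fun b hb hb0 => by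
      obtain ⟨i, rfl⟩ := hzero b hb hb0
      exact hδ ▸ hfar i
  obtain ⟨y, hy, hle⟩ := exists_norm_le_half_forall_norm_le_mul hcard (by linarith) (by linarith)
    (fun i => mem_closedBall_zero_iff.mp (ha i)) (hφ.mono ball_subset_closedBall).differentiableOn
    (fun w hw => hφ0 w (ball_subset_closedBall hw)) hx
  refine HasTaylorIndexLE.of_norm_le (by linarith) (hh.differentiableOn.diffContOnCl_ball
    (closedBall_subset_closedBall (by linarith))) hN.le hy fun w hw => ?_
  rw [hfactor]
  exact hle w (closedBall_subset_closedBall hAx (sphere_subset_closedBall hw))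

end IndexBound

section Slice

variable {n : ℕ} {b : EuclideanSpace ℂ (Fin n)} {L : EuclideanSpace ℂ (Fin n) → ℝ}
  {F : EuclideanSpace ℂ (Fin n) → ℂ} {z : EuclideanSpace ℂ (Fin n)}

lemma zero_mem_sliceDomain_iff : 0 ∈ sliceDomain b z ↔ z ∈ unitBall n := by
  simp [sliceDomain]

lemma mem_sliceDomain_add_smul_iff {t u : ℂ} :
    u ∈ sliceDomain b (z + t • b) ↔ t + u ∈ sliceDomain b z := by
  simp [sliceDomain, add_smul, add_assoc]

lemma exists_slice_ne_zero_add_smul_iff (t : ℂ) :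
    (∃ u ∈ sliceDomain b (z + t • b), F (z + t • b + u • b) ≠ 0) ↔
      ∃ u ∈ sliceDomain b z, F (z + u • b) ≠ 0 := by
  simp only [mem_sliceDomain_add_smul_iff, add_assoc, ← add_smul]
  exact ((Equiv.addLeft t).surjective.exists
    (p := fun u => u ∈ sliceDomain b z ∧ F (z + u • b) ≠ 0)).symm

lemma isOpen_sliceDomain (b z : EuclideanSpace ℂ (Fin n)) : IsOpen (sliceDomain b z) :=
  isOpen_ball.preimage (f := fun t : ℂ => z + t • b) (by fun_prop)

lemma convex_sliceDomain (b z : EuclideanSpace ℂ (Fin n)) : Convex ℝ (sliceDomain b z) := by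
  have hline := (convex_ball (0 : EuclideanSpace ℂ (Fin n)) 1).translate_preimage_right z
  exact hline.linear_preimage ((LinearMap.toSpanSingleton ℂ _ b).restrictScalars ℝ)

lemma analyticOnNhd_slice (hF : AnalyticOnNhd ℂ F (unitBall n)) (b z : EuclideanSpace ℂ (Fin n)) :
    AnalyticOnNhd ℂ (fun t : ℂ => F (z + t • b)) (sliceDomain b z) := fun t ht =>
  AnalyticAt.comp (f := fun t : ℂ => z + t • b) (hF _ ht) (by fun_prop)

lemma iterDirDeriv_analyticOnNhd (hF : AnalyticOnNhd ℂ F (unitBall n))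
    (b : EuclideanSpace ℂ (Fin n)) (k : ℕ) :
    AnalyticOnNhd ℂ (iterDirDeriv b k F) (unitBall n) := by
  induction k with
  | zero => exact hF
  | succ k ih =>
    exact fun z hz => ((ContinuousLinearMap.apply ℂ ℂ b).analyticAt _).comp (ih.fderiv z hz)

lemma iterDirDeriv_smul (c : ℂ) (b : EuclideanSpace ℂ (Fin n))
    (F : EuclideanSpace ℂ (Fin n) → ℂ) (k : ℕ) :
    iterDirDeriv (c • b) k F = c ^ k • iterDirDeriv b k F := by
  induction k with
  | zero => simp [iterDirDeriv]
  | succ k ih =>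
    ext z
    simp only [iterDirDeriv, dirDeriv, ih, fderiv_const_smul_field, Pi.smul_apply, map_smul,
      smul_apply, smul_eq_mul]
    ring

lemma iteratedDeriv_slice (hF : AnalyticOnNhd ℂ F (unitBall n)) (k : ℕ) {t : ℂ}
    (ht : t ∈ sliceDomain b z) :
    iteratedDeriv k (fun t : ℂ => F (z + t • b)) t = iterDirDeriv b k F (z + t • b) := by
  induction k generalizing t with
  | zero => simp [iterDirDeriv]
  | succ k ih =>
    have hev : iteratedDeriv k (fun t : ℂ => F (z + t • b)) =ᶠ[nhds t]
        fun t => iterDirDeriv b k F (z + t • b) :=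
      Filter.eventually_of_mem ((isOpen_sliceDomain b z).mem_nhds ht) fun _ => ih
    have hline : HasDerivAt (fun t : ℂ => z + t • b) b t := by
      simpa using ((hasDerivAt_id t).smul_const b).const_add z
    rw [iteratedDeriv_succ, hev.deriv_eq]
    exact ((iterDirDeriv_analyticOnNhd hF b k _ ht).differentiableAt.hasFDerivAt.comp_hasDerivAt t
      hline).deriv

/-- The slice function of `F` through `z` in the direction `b`, with the parameter rescaled by
`L z`, so that `z` corresponds to the origin and the scale `1 / L z` to radius one. -/
noncomputable def rescaledSlice (b : EuclideanSpace ℂ (Fin n)) (L : EuclideanSpace ℂ (Fin n) → ℝ)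
    (F : EuclideanSpace ℂ (Fin n) → ℂ) (z : EuclideanSpace ℂ (Fin n)) : ℂ → ℂ :=
  fun w => F (z + (w / L z) • b)

lemma rescaledSlice_add_smul (z : EuclideanSpace ℂ (Fin n)) (t w : ℂ) :
    rescaledSlice b L F (z + t • b) w = F (z + (t + w * (L (z + t • b) : ℂ)⁻¹) • b) := by
  rw [rescaledSlice, add_assoc, ← add_smul, div_eq_mul_inv]

lemma taylorCoeffNorm_rescaledSlice (hF : AnalyticOnNhd ℂ F (unitBall n)) (hz : z ∈ unitBall n)
    (hLz : 0 ≤ L z) (k : ℕ) :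
    taylorCoeffNorm (rescaledSlice b L F z) k =
      ‖iterDirDeriv b k F z‖ / ((k.factorial : ℝ) * L z ^ k) := by
  have hslice : rescaledSlice b L F z = fun w : ℂ => F (z + w • ((L z : ℂ)⁻¹ • b)) := by
    ext w
    rw [rescaledSlice, smul_smul, div_eq_mul_inv]
  rw [taylorCoeffNorm, hslice, iteratedDeriv_slice hF k (zero_mem_sliceDomain_iff.mpr hz),
    iterDirDeriv_smul, zero_smul, add_zero, Pi.smul_apply, norm_smul, norm_pow, norm_inv,
    Complex.norm_of_nonneg hLz]
  ring

lemma logDeriv_rescaledSlice (hF : AnalyticOnNhd ℂ F (unitBall n)) {w : ℂ}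
    (hw : w / L z ∈ sliceDomain b z) :
    logDeriv (rescaledSlice b L F z) w =
      1 / F (z + (w / L z) • b) * dirDeriv b F (z + (w / L z) • b) / L z := by
  have hline : HasDerivAt (fun w : ℂ => z + (w / (L z : ℂ)) • b) ((1 / (L z : ℂ)) • b) w :=
    (((hasDerivAt_id w).div_const (L z : ℂ)).smul_const b).const_add z
  have hderiv : deriv (rescaledSlice b L F z) w =
      fderiv ℂ F (z + (w / L z) • b) ((1 / (L z : ℂ)) • b) :=
    ((hF _ hw).differentiableAt.hasFDerivAt.comp_hasDerivAt w hline).deriv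
  rw [logDeriv_apply, hderiv, map_smul, dirDeriv, smul_eq_mul, rescaledSlice]
  ring

lemma exists_rescaledSlice_ne_zero (hF : AnalyticOnNhd ℂ F (unitBall n)) (hz : z ∈ unitBall n)
    (hLz : 0 < L z) (hne : ∃ t ∈ sliceDomain b z, F (z + t • b) ≠ 0) :
    ∃ w ∈ ball (0 : ℂ) 1, rescaledSlice b L F z w ≠ 0 := by
  by_contra! hzero
  have hev : (fun t : ℂ => F (z + t • b)) =ᶠ[nhds 0] 0 := by
    filter_upwards [ball_mem_nhds (0 : ℂ) (one_div_pos.mpr hLz)] with t ht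
    have htL : t * L z ∈ ball (0 : ℂ) 1 := by
      rw [mem_ball_zero_iff, lt_div_iff₀ hLz] at ht
      rwa [mem_ball_zero_iff, norm_mul, Complex.norm_of_nonneg hLz.le]
    simpa [rescaledSlice, hLz.ne'] using hzero _ htL
  obtain ⟨t, ht, hFt⟩ := hne
  exact hFt ((analyticOnNhd_slice hF b z).eqOn_zero_of_preconnected_of_eventuallyEq_zero
    (convex_sliceDomain b z).isPreconnected (zero_mem_sliceDomain_iff.mpr hz) hev ht)

lemma notMem_exceptionalSet_iff (hz : z ∈ unitBall n) {r : ℝ} :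
    z ∉ exceptionalSet b L F r ↔ (∃ t ∈ sliceDomain b z, F (z + t • b) ≠ 0) ∧
      ∀ a ∈ sliceZeros b F z, r / L (z + a • b) < ‖a‖ := by
  constructor
  · intro hzG
    have hz_slice : z ∉ sliceExceptionalSet b L F r z := fun h => hzG (Set.mem_biUnion hz h)
    rw [sliceExceptionalSet] at hz_slice
    split_ifs at hz_slice with hzero
    · exact absurd ⟨0, zero_mem_sliceDomain_iff.mpr hz, by simp⟩ hz_slice
    · push Not at hzero
      refine ⟨hzero, fun a ha => ?_⟩
      by_contra! hle
      exact hz_slice (Set.mem_biUnion ha ⟨0, by simpa using hle, by simp⟩)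
  · rintro ⟨hne, hfar⟩ hzG
    obtain ⟨z₀, -, hmem⟩ := Set.mem_iUnion₂.mp hzG
    rw [sliceExceptionalSet] at hmem
    split_ifs at hmem with hzero
    · obtain ⟨u, -, rfl⟩ := hmem
      obtain ⟨t, ht, hFt⟩ := (exists_slice_ne_zero_add_smul_iff u).mp hne
      exact hFt (hzero t ht)
    · obtain ⟨a, ⟨ha, hFa⟩, u, hu, rfl⟩ := Set.mem_iUnion₂.mp hmem
      have hshift : z₀ + u • b + (a - u) • b = z₀ + a • b := by
        rw [add_assoc, ← add_smul, add_sub_cancel]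
      have hlt := hfar (a - u)
        ⟨mem_sliceDomain_add_smul_iff.mpr (by rwa [add_sub_cancel]), by rwa [hshift]⟩
      rw [hshift, ← dist_eq_norm, dist_comm] at hlt
      exact hlt.not_ge hu

end Slice

section ClassQ

variable {n : ℕ} {b : EuclideanSpace ℂ (Fin n)} {β Λ : ℝ} {L : EuclideanSpace ℂ (Fin n) → ℝ}
  {F : EuclideanSpace ℂ (Fin n) → ℂ} {z : EuclideanSpace ℂ (Fin n)} {w : ℂ}

lemma MemQ.div_mem_sliceDomain (hL : MemQ b β L) (hz : z ∈ unitBall n) (hw : ‖w‖ ≤ β) :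
    w / L z ∈ sliceDomain b z := by
  have hLz := hL.pos z hz
  have hgap : 0 < 1 - ‖z‖ := sub_pos.mpr (mem_ball_zero_iff.mp hz)
  have hstep : ‖(w / (L z : ℂ)) • b‖ < 1 - ‖z‖ :=
    calc ‖(w / (L z : ℂ)) • b‖ = ‖w‖ * ‖b‖ / L z := by
          rw [norm_smul, norm_div, Complex.norm_of_nonneg hLz.le, div_mul_eq_mul_div]
      _ ≤ β * ‖b‖ / L z := by gcongr
      _ < 1 - ‖z‖ := (div_lt_comm₀ hgap hLz).mp (hL.lower_bound z hz)
  exact mem_ball_zero_iff.mpr (by linarith [norm_add_le z ((w / (L z : ℂ)) • b)])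

lemma MemQ.analyticOnNhd_rescaledSlice (hL : MemQ b β L) (hF : AnalyticOnNhd ℂ F (unitBall n))
    (hz : z ∈ unitBall n) : AnalyticOnNhd ℂ (rescaledSlice b L F z) (closedBall 0 β) :=
  fun w hw => AnalyticAt.comp (f := fun w : ℂ => w / (L z : ℂ))
    (analyticOnNhd_slice hF b z _ (hL.div_mem_sliceDomain hz (mem_closedBall_zero_iff.mp hw)))
    (by fun_prop)

lemma MemQ.hasBoundedLIndexInDirection_iff (hL : MemQ b β L)
    (hF : AnalyticOnNhd ℂ F (unitBall n)) :
    HasBoundedLIndexInDirection b L F ↔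
      ∃ N, ∀ z ∈ unitBall n, HasTaylorIndexLE (rescaledSlice b L F z) N := by
  have hcoeff {z} (hz : z ∈ unitBall n) :=
    taylorCoeffNorm_rescaledSlice (b := b) hF hz (hL.pos z hz).le
  refine exists_congr fun N => ⟨fun hN z hz => ?_, fun hN m z hz => ?_⟩
  · obtain ⟨k, hk, hmax⟩ := exists_taylorCoeffNorm_le (rescaledSlice b L F z) N
    simp only [HasTaylorIndexLE, hcoeff hz] at hmax ⊢
    exact ⟨k, hk, fun m => (hN m z hz).trans
      (Finset.sup'_le _ _ fun j hj => hmax j (Finset.mem_range_succ_iff.mp hj))⟩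
  · obtain ⟨k, hk, hmax⟩ := hN z hz
    simp only [hcoeff hz] at hmax
    exact (Finset.le_sup'_iff _).mpr ⟨k, Finset.mem_range_succ_iff.mpr hk, hmax m⟩

/-- `L` varies by at most the factor `Λ` on the discs of radius `β / L` in the direction `b`: the
two-sided bound that the conditions on `λ₁(β)` and `λ₂(β)` provide. -/
def IsSliceComparable (b : EuclideanSpace ℂ (Fin n)) (β : ℝ) (L : EuclideanSpace ℂ (Fin n) → ℝ)
    (Λ : ℝ) : Prop :=
  ∀ z ∈ unitBall n, ∀ w : ℂ, ‖w‖ ≤ β →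
    L (z + (w / L z) • b) ≤ Λ * L z ∧ L z ≤ Λ * L (z + (w / L z) • b)

lemma lambdaInf_le_ofReal_le_lambdaSup (hz : z ∈ unitBall n) (hLz : 0 < L z) (hw : ‖w‖ ≤ β) :
    lambdaInf b L β ≤ ENNReal.ofReal (L (z + (w / L z) • b) / L z) ∧
      ENNReal.ofReal (L (z + (w / L z) • b) / L z) ≤ lambdaSup b L β := by
  have h0 := zero_mem_sliceDomain_iff (b := b).mpr hz
  have hz0 : z + (0 : ℂ) • b = z := by simp
  have hmem : w / L z ∈ closedBall (0 : ℂ) (β / L (z + (0 : ℂ) • b)) := by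
    rw [mem_closedBall_zero_iff, hz0, norm_div, Complex.norm_of_nonneg hLz.le]
    gcongr
  constructor
  · refine iInf₂_le_of_le z hz (iInf₂_le_of_le 0 h0 (iInf₂_le_of_le _ hmem ?_))
    rw [hz0]
  · refine le_iSup₂_of_le z hz (le_iSup₂_of_le 0 h0 (le_iSup₂_of_le _ hmem ?_))
    rw [hz0]

lemma MemQ.exists_isSliceComparable (hL : MemQ b β L) (hβ : 0 ≤ β) :
    ∃ Λ, 0 < Λ ∧ IsSliceComparable b β L Λ := by
  obtain ⟨hinf_pos, hinf_sup, hsup_top⟩ := hL.lambda β ⟨hβ, le_rfl⟩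
  have hinf_top := (hinf_sup.trans_lt hsup_top).ne
  have hinf : 0 < (lambdaInf b L β).toReal := ENNReal.toReal_pos hinf_pos.ne' hinf_top
  refine ⟨max (lambdaSup b L β).toReal (lambdaInf b L β).toReal⁻¹,
    lt_max_of_lt_right (inv_pos.mpr hinf), fun z hz w hw => ?_⟩
  have hLz := hL.pos z hz
  have hLw : 0 < L (z + (w / L z) • b) := hL.pos _ (hL.div_mem_sliceDomain hz hw)
  obtain ⟨hle_ratio, hratio_le⟩ := lambdaInf_le_ofReal_le_lambdaSup hz hLz hw
  constructor
  · rw [ENNReal.ofReal_le_iff_le_toReal hsup_top.ne, div_le_iff₀ hLz] at hratio_le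
    exact hratio_le.trans (by gcongr; exact le_max_left _ _)
  · rw [ENNReal.le_ofReal_iff_toReal_le hinf_top (by positivity), le_div_iff₀ hLz,
      ← le_inv_mul_iff₀ hinf] at hle_ratio
    exact hle_ratio.trans (by gcongr; exact le_max_right _ _)

lemma MemQ.zeroCount_eq (hL : MemQ b β L) {r : ℝ} (hr : r ≤ β) {t₀ : ℂ}
    (ht₀ : t₀ ∈ sliceDomain b z) :
    zeroCount b F (r / L (z + t₀ • b)) z t₀ =
      zeroCountOn (rescaledSlice b L F (z + t₀ • b)) (closedBall 0 r) := by
  have hLp := hL.pos _ ht₀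
  have hradius : r * ‖(L (z + t₀ • b) : ℂ)⁻¹‖ = r / L (z + t₀ • b) := by
    rw [norm_inv, Complex.norm_of_nonneg hLp.le, div_eq_mul_inv]
  have hzeros : sliceZeros b F z ∩ closedBall t₀ (r / L (z + t₀ • b)) =
      closedBall t₀ (r / L (z + t₀ • b)) ∩ {t | F (z + t • b) = 0} := by
    ext a
    refine ⟨fun ha => ⟨ha.2, ha.1.2⟩, fun ha => ⟨⟨?_, ha.2⟩, ha.1⟩⟩
    have hw : ‖(a - t₀) * L (z + t₀ • b)‖ ≤ β := by
      rw [norm_mul, Complex.norm_of_nonneg hLp.le, ← le_div_iff₀ hLp]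
      exact (mem_closedBall_iff_norm.mp ha.1).trans (by gcongr)
    simpa [mem_sliceDomain_add_smul_iff, hLp.ne'] using hL.div_mem_sliceDomain ht₀ hw
  calc zeroCount b F (r / L (z + t₀ • b)) z t₀
      = zeroCountOn (fun t : ℂ => F (z + t • b)) (closedBall t₀ (r / L (z + t₀ • b))) := by
        rw [← zeroCountOn_inter_zeros, ← hzeros]
        rfl
    _ = _ := by
        rw [← hradius, ← zeroCountOn_comp_add_mul _ _ (inv_ne_zero (by exact_mod_cast hLp.ne'))]
        simp only [← rescaledSlice_add_smul]

lemma IsSliceComparable.le_mul_add_smul (hΛ : IsSliceComparable b β L Λ) {t : ℂ}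
    (ht : t ∈ sliceDomain b z) (hLt : 0 < L (z + t • b)) (htβ : ‖t‖ * L (z + t • b) ≤ β) :
    L z ≤ Λ * L (z + t • b) := by
  have hnorm : ‖-(t * L (z + t • b))‖ ≤ β := by
    rwa [norm_neg, norm_mul, Complex.norm_of_nonneg hLt.le]
  have hback : -(t * (L (z + t • b) : ℂ)) / L (z + t • b) = -t := by
    rw [neg_div, mul_div_cancel_right₀ _ (by exact_mod_cast hLt.ne')]
  simpa [hback] using (hΛ (z + t • b) ht _ hnorm).1

lemma MemQ.rescaledSlice_ne_zero_of_notMem_exceptionalSet (hL : MemQ b β L)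
    (hΛ : IsSliceComparable b β L Λ) (hz : z ∈ unitBall n) {r : ℝ}
    (hzG : z ∉ exceptionalSet b L F r) (hwβ : ‖w‖ ≤ β) (hwr : ‖w‖ * Λ ≤ r) :
    rescaledSlice b L F z w ≠ 0 := by
  intro hzero
  have hLz := hL.pos z hz
  have hmem := hL.div_mem_sliceDomain hz hwβ
  have hfar := ((notMem_exceptionalSet_iff hz).mp hzG).2 _ ⟨hmem, hzero⟩
  rw [norm_div, Complex.norm_of_nonneg hLz.le, div_lt_div_iff₀ (hL.pos _ hmem) hLz] at hfar
  refine hfar.not_ge ?_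
  calc ‖w‖ * L (z + (w / L z) • b) ≤ ‖w‖ * (Λ * L z) := by gcongr; exact (hΛ z hz w hwβ).1
    _ = ‖w‖ * Λ * L z := by ring
    _ ≤ r * L z := by gcongr

lemma MemQ.add_smul_notMem_exceptionalSet (hL : MemQ b β L) (hΛ₀ : 0 ≤ Λ)
    (hΛ : IsSliceComparable b β L Λ) (hz : z ∈ unitBall n)
    (hne : ∃ t ∈ sliceDomain b z, F (z + t • b) ≠ 0) {r c : ℝ} (hrβ : r ≤ β)
    (hrc : r * Λ ^ 2 < c) (hwc : ‖w‖ + c ≤ β) (hwβ : ‖w‖ ≤ β)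
    (hfar : ∀ a ∈ closedBall (0 : ℂ) β, rescaledSlice b L F z a = 0 → c ≤ ‖w - a‖) :
    z + (w / L z) • b ∉ exceptionalSet b L F r := by
  have hLz := hL.pos z hz
  have hp := hL.div_mem_sliceDomain hz hwβ
  refine (notMem_exceptionalSet_iff hp).mpr ⟨(exists_slice_ne_zero_add_smul_iff _).mpr hne, ?_⟩
  rintro a ⟨ha, hFa⟩
  by_contra! hclose
  have hLa := hL.pos _ ha
  rw [le_div_iff₀ hLa] at hclose
  have hdist : ‖a * L z‖ < c :=
    calc ‖a * L z‖ = ‖a‖ * L z := by rw [norm_mul, Complex.norm_of_nonneg hLz.le]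
      _ ≤ ‖a‖ * (Λ * (Λ * L (z + (w / L z) • b + a • b))) := by
        gcongr
        refine (hΛ z hz w hwβ).2.trans ?_
        gcongr
        exact hΛ.le_mul_add_smul ha hLa (hclose.trans hrβ)
      _ = ‖a‖ * L (z + (w / L z) • b + a • b) * Λ ^ 2 := by ring
      _ ≤ r * Λ ^ 2 := by gcongr
      _ < c := hrc
  have hmem : w + a * L z ∈ closedBall (0 : ℂ) β :=
    mem_closedBall_zero_iff.mpr (by linarith [norm_add_le w (a * L z)])
  have hzero : rescaledSlice b L F z (w + a * L z) = 0 := by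
    rwa [rescaledSlice, add_div, mul_div_cancel_right₀ _ (by exact_mod_cast hLz.ne'), add_smul,
      ← add_assoc]
  have hge := hfar _ hmem hzero
  rw [sub_add_cancel_left, norm_neg] at hge
  exact hdist.not_ge hge

lemma MemQ.norm_logDeriv_rescaledSlice_le_iff (hL : MemQ b β L)
    (hF : AnalyticOnNhd ℂ F (unitBall n)) (hz : z ∈ unitBall n) (hw : ‖w‖ ≤ β) {K : ℝ} :
    ‖logDeriv (rescaledSlice b L F z) w‖ ≤ K ↔
      ‖1 / F (z + (w / L z) • b) * dirDeriv b F (z + (w / L z) • b)‖ ≤ K * L z := by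
  have hLz := hL.pos z hz
  rw [logDeriv_rescaledSlice hF (hL.div_mem_sliceDomain hz hw), norm_div,
    Complex.norm_of_nonneg hLz.le, div_le_iff₀ hLz]

lemma MemQ.exists_norm_dirDeriv_le_of_hasTaylorIndexLE (hL : MemQ b β L) (hβ : 1 ≤ β)
    (hF : AnalyticOnNhd ℂ F (unitBall n)) {N : ℕ}
    (hN : ∀ z ∈ unitBall n, HasTaylorIndexLE (rescaledSlice b L F z) N) {r : ℝ} (hr : 0 < r) :
    ∃ P : ℝ, 0 < P ∧ ∀ z ∈ unitBall n \ exceptionalSet b L F r,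
      ‖1 / F z * dirDeriv b F z‖ ≤ P * L z := by
  obtain ⟨Λ, hΛ₀, hΛ⟩ := hL.exists_isSliceComparable (by linarith)
  set s := min (r / Λ) (1 / 2)
  have hs : 0 < s := lt_min (by positivity) (by norm_num)
  have hsr : s * Λ ≤ r := (le_div_iff₀ hΛ₀).mp (min_le_left _ _)
  have hs2 : s ≤ 1 / 2 := min_le_right _ _
  refine ⟨3 * (5 / s) ^ (2 * N), by positivity, fun z ⟨hz, hzG⟩ => ?_⟩
  have hdiff : DifferentiableOn ℂ (rescaledSlice b L F z) (ball 0 1) :=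
    (hL.analyticOnNhd_rescaledSlice hF hz).differentiableOn.mono
      ((ball_subset_ball hβ).trans ball_subset_closedBall)
  have hne : ∀ w ∈ ball (0 : ℂ) s, rescaledSlice b L F z w ≠ 0 := by
    intro w hw
    rw [mem_ball_zero_iff] at hw
    exact hL.rescaledSlice_ne_zero_of_notMem_exceptionalSet hΛ hz hzG (by linarith)
      ((by gcongr : ‖w‖ * Λ ≤ s * Λ).trans hsr)
  simpa using (hL.norm_logDeriv_rescaledSlice_le_iff hF hz (w := 0) (by simp; linarith)).mp
    (norm_logDeriv_zero_le_of_hasTaylorIndexLE hdiff (hN z hz) hs hs2 hne)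

lemma zeroCountOn_rescaledSlice_add_smul (hLz : 0 < L z) (hLp : 0 < L (z + (w / L z) • b))
    (ρ : ℝ) :
    zeroCountOn (rescaledSlice b L F (z + (w / L z) • b)) (closedBall 0 ρ) =
      zeroCountOn (rescaledSlice b L F z) (closedBall w (ρ * (L z / L (z + (w / L z) • b)))) := by
  set s : ℝ := L z / L (z + (w / L z) • b)
  have hs : 0 < s := div_pos hLz hLp
  have hrecentre : rescaledSlice b L F (z + (w / L z) • b) =
      fun v => rescaledSlice b L F z (w + v * s) := by
    ext v
    rw [rescaledSlice_add_smul, rescaledSlice]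
    congr 3
    have hLz' : (L z : ℂ) ≠ 0 := by exact_mod_cast hLz.ne'
    simp only [s, Complex.ofReal_div]
    field_simp
  rw [hrecentre, zeroCountOn_comp_add_mul _ _ (by exact_mod_cast hs.ne'),
    Complex.norm_of_nonneg hs.le]

lemma MemQ.exists_zeroCountOn_rescaledSlice_le_of_hasTaylorIndexLE (hL : MemQ b β L) (hβ : 1 ≤ β)
    (hF : AnalyticOnNhd ℂ F (unitBall n)) {N : ℕ}
    (hN : ∀ z ∈ unitBall n, HasTaylorIndexLE (rescaledSlice b L F z) N) :
    ∃ M : ℕ, ∀ z ∈ unitBall n, (∃ t ∈ sliceDomain b z, F (z + t • b) ≠ 0) →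
      zeroCountOn (rescaledSlice b L F z) (closedBall 0 β) ≤ M := by
  obtain ⟨q, hq⟩ := exists_zeroCountOn_le_of_hasTaylorIndexLE ℂ N
  obtain ⟨Λ, hΛ₀, hΛ⟩ := hL.exists_isSliceComparable (by linarith)
  obtain ⟨T, hTβ, hT, hcover⟩ := (isCompact_closedBall (0 : ℂ) β).finite_cover_balls
    (e := 1 / (8 * Λ)) (by positivity)
  lift T to Finset ℂ using hT
  refine ⟨T.card * q, fun z hz hne => ?_⟩
  have hLz := hL.pos z hz
  have hsmall : ∀ τ ∈ T,
      zeroCountOn (rescaledSlice b L F z) (closedBall τ (1 / (8 * Λ))) ≤ q := by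
    intro τ hτ
    have hτβ : ‖τ‖ ≤ β := mem_closedBall_zero_iff.mp (hTβ hτ)
    have hp := hL.div_mem_sliceDomain hz hτβ
    have hLp := hL.pos _ hp
    have hradius : 1 / (8 * Λ) ≤ 1 / 8 * (L z / L (z + (τ / L z) • b)) := by
      rw [← mul_div_assoc, div_le_div_iff₀ (by positivity) hLp]
      linarith [(hΛ z hz τ hτβ).1]
    calc zeroCountOn (rescaledSlice b L F z) (closedBall τ (1 / (8 * Λ)))
        ≤ zeroCountOn (rescaledSlice b L F z)
            (closedBall τ (1 / 8 * (L z / L (z + (τ / L z) • b)))) :=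
          zeroCountOn_mono (closedBall_subset_closedBall hradius)
      _ = zeroCountOn (rescaledSlice b L F (z + (τ / L z) • b)) (closedBall 0 (1 / 8)) :=
          (zeroCountOn_rescaledSlice_add_smul hLz hLp _).symm
      _ ≤ q := hq _ ((hL.analyticOnNhd_rescaledSlice hF hp).mono
          ((ball_subset_ball hβ).trans ball_subset_closedBall)) (hN _ hp)
          (exists_rescaledSlice_ne_zero hF hp hLp ((exists_slice_ne_zero_add_smul_iff _).mpr hne))
  calc zeroCountOn (rescaledSlice b L F z) (closedBall 0 β)
      ≤ zeroCountOn (rescaledSlice b L F z) (⋃ τ ∈ T, closedBall τ (1 / (8 * Λ))) :=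
        zeroCountOn_mono (hcover.trans (Set.iUnion₂_mono fun _ _ => ball_subset_closedBall))
    _ ≤ ∑ τ ∈ T, zeroCountOn (rescaledSlice b L F z) (closedBall τ (1 / (8 * Λ))) :=
        zeroCountOn_biUnion_le _ T _
    _ ≤ ((T.card * q : ℕ) : ℕ∞) := by
        simpa using Finset.sum_le_card_nsmul T _ _ hsmall

lemma MemQ.exists_hasTaylorIndexLE_rescaledSlice (hL : MemQ b β L) (hβ : 1 < β)
    (hF : AnalyticOnNhd ℂ F (unitBall n))
    (hlog : ∀ r : ℝ, 0 < r → r ≤ β → ∃ P : ℝ, 0 < P ∧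
      ∀ z ∈ unitBall n \ exceptionalSet b L F r, ‖1 / F z * dirDeriv b F z‖ ≤ P * L z) {q : ℕ}
    (hcount : ∀ z ∈ unitBall n, (∃ t ∈ sliceDomain b z, F (z + t • b) ≠ 0) →
      zeroCountOn (rescaledSlice b L F z) (closedBall 0 β) ≤ q) :
    ∃ N, ∀ z ∈ unitBall n, HasTaylorIndexLE (rescaledSlice b L F z) N := by
  obtain ⟨Λ, hΛ₀, hΛ⟩ := hL.exists_isSliceComparable (by linarith)
  set c := min ((β - 1) / (8 * (q + 1))) ((β - 1) / 2)
  have hβ₁ : 0 < β - 1 := sub_pos.mpr hβ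
  have hc : 0 < c := lt_min (div_pos hβ₁ (by positivity)) (half_pos hβ₁)
  have hcβ : c ≤ (β - 1) / 2 := min_le_right _ _
  set r := min β (c / (2 * Λ ^ 2))
  have hrc : r * Λ ^ 2 < c := by
    have hr : r * (2 * Λ ^ 2) ≤ c := (le_div_iff₀ (by positivity)).mp (min_le_right _ _)
    linarith
  obtain ⟨P, hP, hPle⟩ := hlog r (lt_min (by linarith) (by positivity)) (min_le_left _ _)
  obtain ⟨N, hN⟩ := exists_hasTaylorIndexLE_of_norm_logDeriv_le hβ q (P * Λ)
  refine ⟨N, fun z hz => ?_⟩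
  by_cases hne : ∃ t ∈ sliceDomain b z, F (z + t • b) ≠ 0
  · refine hN _ (hL.analyticOnNhd_rescaledSlice hF hz) (hcount z hz hne) fun w hw hfar => ?_
    rw [mem_closedBall_zero_iff] at hw
    have hwβ : ‖w‖ ≤ β := by linarith
    have hp := hL.div_mem_sliceDomain hz hwβ
    have hpG := hL.add_smul_notMem_exceptionalSet hΛ₀.le hΛ hz hne (min_le_left _ _) hrc
      (by linarith) hwβ fun a ha h0 => (min_le_left _ _).trans (hfar a ha h0)
    rw [hL.norm_logDeriv_rescaledSlice_le_iff hF hz hwβ, mul_assoc]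
    exact (hPle _ ⟨hp, hpG⟩).trans (by gcongr; exact (hΛ z hz w hwβ).1)
  · push Not at hne
    refine hasTaylorIndexLE_of_eventuallyEq_zero ?_ N
    filter_upwards [closedBall_mem_nhds (0 : ℂ) (zero_lt_one.trans hβ)] with w hw
    exact hne _ (hL.div_mem_sliceDomain hz (mem_closedBall_zero_iff.mp hw))

end ClassQ

theorem theorem12_general {n : ℕ} (b : EuclideanSpace ℂ (Fin n)) (β : ℝ) (hβ : 1 < β)
    (L : EuclideanSpace ℂ (Fin n) → ℝ) (hL : MemQ b β L)
    (F : EuclideanSpace ℂ (Fin n) → ℂ) (hF : AnalyticOnNhd ℂ F (unitBall n)) :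
    HasBoundedLIndexInDirection b L F ↔
      (∀ r : ℝ, 0 < r → r ≤ β → ∃ P : ℝ, 0 < P ∧
        ∀ z ∈ unitBall n \ exceptionalSet b L F r,
          ‖1 / F z * dirDeriv b F z‖ ≤ P * L z) ∧
      (∀ r : ℝ, 0 < r → r ≤ β → ∃ N : ℕ, ∀ z₀ ∈ unitBall n,
        (∃ t ∈ sliceDomain b z₀, F (z₀ + t • b) ≠ 0) →
        ∀ t₀ ∈ sliceDomain b z₀,
          zeroCount b F (r / L (z₀ + t₀ • b)) z₀ t₀ ≤ (N : ℕ∞)) := by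
  rw [hL.hasBoundedLIndexInDirection_iff hF]
  constructor
  · rintro ⟨N, hN⟩
    refine ⟨fun r hr _ => hL.exists_norm_dirDeriv_le_of_hasTaylorIndexLE hβ.le hF hN hr,
      fun r _ hrβ => ?_⟩
    obtain ⟨M, hM⟩ := hL.exists_zeroCountOn_rescaledSlice_le_of_hasTaylorIndexLE hβ.le hF hN
    refine ⟨M, fun z₀ _ hne t₀ ht₀ => ?_⟩
    rw [hL.zeroCount_eq hrβ ht₀]
    exact (zeroCountOn_mono (closedBall_subset_closedBall hrβ)).trans
      (hM _ ht₀ ((exists_slice_ne_zero_add_smul_iff t₀).mpr hne))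
  · rintro ⟨hlog, hcount⟩
    obtain ⟨q, hq⟩ := hcount β (zero_lt_one.trans hβ) le_rfl
    refine hL.exists_hasTaylorIndexLE_rescaledSlice hβ hF hlog (q := q) fun z hz hne => ?_
    have h0 := (zero_mem_sliceDomain_iff (b := b)).mpr hz
    have hle := hq z hz hne 0 h0
    rwa [hL.zeroCount_eq le_rfl h0, zero_smul, add_zero] at hle

theorem theorem12 {n : ℕ} (b : EuclideanSpace ℂ (Fin n)) (hb : b ≠ 0) (β : ℝ) (hβ : 1 < β)
    (L : EuclideanSpace ℂ (Fin n) → ℝ) (hL : MemQ b β L)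
    (F : EuclideanSpace ℂ (Fin n) → ℂ) (hF : AnalyticOnNhd ℂ F (unitBall n))
    (hG : (unitBall n \ exceptionalSet b L F β).Nonempty) :
    HasBoundedLIndexInDirection b L F ↔
      (∀ r : ℝ, 0 < r → r ≤ β → ∃ P : ℝ, 0 < P ∧
        ∀ z ∈ unitBall n \ exceptionalSet b L F r,
          ‖1 / F z * dirDeriv b F z‖ ≤ P * L z) ∧
      (∀ r : ℝ, 0 < r → r ≤ β → ∃ N : ℕ, ∀ z₀ ∈ unitBall n,
        (∃ t ∈ sliceDomain b z₀, F (z₀ + t • b) ≠ 0) →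
        ∀ t₀ ∈ sliceDomain b z₀,
          zeroCount b F (r / L (z₀ + t₀ • b)) z₀ t₀ ≤ (N : ℕ∞)) :=
  theorem12_general b β hβ L hL F hF
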